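/- Let $\ell\ge 1$, let $S=\mathbb{R}[x_1,\dots,x_\ell,z]$, and write $\partial_i=\partial/\partial x_i$, $\partial_z=\partial/\partial z$. Let $\Phi_+=\{x_i \mid 1\le i\le \ell\}\cup\{x_p\pm x_q \mid 1\le p<q\le \ell\}$ be the positive roots of type $B_\ell$, and let $\mathcal{S}(B_\ell)$ be the cone over the Shi arrangement of type $B_\ell$, i.e. the central arrangement in $\mathbb{R}^{\ell+1}$ defined by $z\prod_{\alpha\in\Phi_+}\alpha(\alpha-z)=0$. Let $D(\mathcal{S}(B_\ell))$ be the $S$-module of all $\mathbb{R}$-linear derivations $\theta:S\to S$ such that $z\mid\theta(z)$ and, for every $\alpha\in\Phi_+$, $\alpha\mid\theta(\alpha)$ and $(\alpha-z)\mid\theta(\alpha-z)$. For integers $r\ge 1$, $s\ge 0$ let $B_{r,s}^{B}(x)\in\mathbb{R}[x]$ be the unique polynomial with $$B_{r,s}^{B}(x+1)-B_{r,s}^{B}(x)=\frac{(x+1)^r-(-x)^r}{(x+1)-(-x)}\,(x+1)^s(-x)^s,\qquad B_{r,s}^{B}(0)=0;$$ it has degree at most $r+2s$. Let $\overline{B}_{r,s}^{B}(x,z)=z^{r+2s}B_{r,s}^{B}(x/z)$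 be its homogenization. For $1\le j\le \ell$ put $$\varphi_j^B=(-1)^j\sum_{i=1}^{\ell}\Biggl\{\sum_{\substack{N_1,N_2\subset\{1,\dots,j-1\}\\ N_1\cap N_2=\emptyset}}\Bigl(\prod_{t\in N_1}x_t^2\Bigr)\Bigl(\prod_{t\in N_2}(-x_tz)\Bigr)\sum_{\substack{0\le k_2\le 1\\ 0\le k_3\le \ell-j}}(-1)^{k_2+k_3}\,x_j^{k_2}\,\sigma_{k_3}(x_{j+1}^2,\dots,x_\ell^2)\,\overline{B}_{r,s}^{B}(x_i,z)\Biggr\}\partial_i,$$ where $\sigma_k$ is the elementary symmetric polynomial of degree $k$, $r=2\ell-2j-k_2-2k_3+2$ and $s=(j-1)-|N_1|-|N_2|$. Let $\theta_E=z\partial_z+\sum_{i=1}^{\ell}x_i\partial_i$ be the Euler derivation. **Theorem.** Each $\varphi_j^B$ is homogeneous of degree $2\ell$ (its values at $x_1,\dots,x_\ell,z$ are homogeneous polynomials of degree $2\ell$, possibly zero), and the derivations $\theta_E,\varphi_1^B,\dots,\varphi_\ell^B$ form a basis of the $S$-module $D(\mathcal{S}(B_\ell))$; in particular they belong to it. 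-/

import Mathlib

namespace ShiB

section BernoulliLike

open Polynomial

/-- `B` satisfies the two conditions that characterize the polynomial `B^B_{r,s}`:
`B(x+1) - B(x) = ((x+1)^r - (-x)^r) / ((x+1) - (-x)) * (x+1)^s (-x)^s` (written with the
denominator `(x+1) - (-x) = 2x+1` cleared, which is equivalent since `ℝ[x]` is a domain)
and `B(0) = 0`. -/
structure IsBernoulliLike (r s : ℕ) (B : ℝ[X]) : Prop where
  difference : ((X + 1) - (-X)) * (B.comp (X + 1) - B) =
    ((X + 1) ^ r - (-X) ^ r) * ((X + 1) ^ s * (-X) ^ s)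
  eval_zero : B.eval 0 = 0

theorem exists_difference_eq (n : ℕ) (q : ℝ[X]) (hq : q.natDegree ≤ n) :
    ∃ B : ℝ[X], B.comp (X + 1) - B = q ∧ B.eval 0 = 0 ∧ B.natDegree ≤ n + 1 := by
  let β : ℕ → ℝ[X] := fun k => (Polynomial.bernoulli (k + 1)).map (algebraMap ℚ ℝ)
  have hβ : ∀ k, (β k).comp (X + 1) - β k = C ((k : ℝ) + 1) * X ^ k := by
    intro k
    have h := congrArg (Polynomial.map (algebraMap ℚ ℝ)) (bernoulli_comp_one_add_X (k + 1))
    simp only [Polynomial.map_comp, Polynomial.map_add, Polynomial.map_one, map_X,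
      nsmul_eq_mul, Polynomial.map_mul, Polynomial.map_pow,
      Polynomial.map_natCast, Nat.add_sub_cancel] at h
    rw [show (X + 1 : ℝ[X]) = 1 + X from add_comm _ _, show (β k).comp (1 + X) = _ from h]
    simp [β]
  have hβd : ∀ k, (β k).natDegree ≤ k + 1 := by
    intro k
    refine natDegree_map_le.trans ?_
    rw [natDegree_le_iff_coeff_eq_zero]
    intro N hN
    rw [coeff_bernoulli, if_neg (by omega)]
  refine ⟨∑ k ∈ Finset.range (n + 1),
    C (q.coeff k / ((k : ℝ) + 1)) * (β k - C ((β k).eval 0)), ?_, ?_, ?_⟩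
  · conv_rhs => rw [q.as_sum_range' (n + 1) (by omega)]
    rw [← coe_compRingHom_apply, map_sum, ← Finset.sum_sub_distrib]
    refine Finset.sum_congr rfl fun k _ => ?_
    have hk : ((k : ℝ) + 1) ≠ 0 := by positivity
    have h := hβ k
    rw [coe_compRingHom_apply, mul_comp, sub_comp, C_comp, C_comp, ← C_mul_X_pow_eq_monomial]
    calc _ = C (q.coeff k / ((k : ℝ) + 1)) * ((β k).comp (X + 1) - β k) := by ring
      _ = _ := by rw [h, ← mul_assoc, ← C_mul, div_mul_cancel₀ _ hk]
  · simp [eval_finsetSum]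
  · refine natDegree_sum_le_of_forall_le _ _ fun k hk => ?_
    refine (natDegree_C_mul_le _ _).trans ?_
    rw [natDegree_sub_C]
    have := hβd k
    have := Finset.mem_range.1 hk
    omega

theorem eq_of_difference_eq {B B' : ℝ[X]} (h : B.comp (X + 1) - B = B'.comp (X + 1) - B')
    (h0 : B.eval 0 = B'.eval 0) : B = B' := by
  have hn : ∀ n : ℕ, B.eval (n : ℝ) = B'.eval (n : ℝ) := by
    intro n
    induction n with
    | zero => simpa using h0
    | succ n ih =>
      have := congrArg (Polynomial.eval (n : ℝ)) h
      simp only [eval_sub, eval_comp, eval_add, eval_X, eval_one] at this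
      push_cast
      linarith
  refine eq_of_infinite_eval_eq _ _ ((Set.infinite_range_of_injective
    (Nat.cast_injective (R := ℝ))).mono ?_)
  rintro _ ⟨n, rfl⟩
  exact hn n

theorem existsUnique_isBernoulliLike (r s : ℕ) :
    ∃! B : ℝ[X], IsBernoulliLike r s B ∧ B.natDegree ≤ r + 2 * s := by
  have hne : ((X + 1) - (-X) : ℝ[X]) ≠ 0 := by
    intro h
    simpa using congrArg (Polynomial.eval (0 : ℝ)) h
  have hex : ∃ B : ℝ[X], IsBernoulliLike r s B ∧ B.natDegree ≤ r + 2 * s := by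
    rcases r with _ | r
    · exact ⟨0, ⟨by simp, by simp⟩, by simp⟩
    · obtain ⟨B, h1, h2, h3⟩ := exists_difference_eq (r + 2 * s)
        ((∑ i ∈ Finset.range (r + 1), (X + 1 : ℝ[X]) ^ i * (-X) ^ (r + 1 - 1 - i)) *
          ((X + 1) ^ s * (-X) ^ s)) (by
        have hX : (X + 1 : ℝ[X]).natDegree ≤ 1 := by compute_degree
        have hY : (-X : ℝ[X]).natDegree ≤ 1 := by compute_degree
        have hXp : ∀ m, ((X + 1 : ℝ[X]) ^ m).natDegree ≤ m := fun m => by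
          simpa using natDegree_pow_le_of_le m hX
        have hYp : ∀ m, ((-X : ℝ[X]) ^ m).natDegree ≤ m := fun m => by
          simpa using natDegree_pow_le_of_le m hY
        refine natDegree_mul_le_of_le (natDegree_sum_le_of_forall_le _ _ fun i hi => ?_)
          ((natDegree_mul_le_of_le (hXp s) (hYp s)).trans (by omega))
        refine (natDegree_mul_le_of_le (hXp i) (hYp _)).trans ?_
        have := Finset.mem_range.1 hi
        omega)
      refine ⟨B, ⟨?_, h2⟩, by omega⟩
      rw [h1, ← mul_assoc, mul_comm ((X + 1) - (-X) : ℝ[X]), geom_sum₂_mul]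
  obtain ⟨B, hB, hd⟩ := hex
  refine ⟨B, ⟨hB, hd⟩, fun B' hB' => ?_⟩
  refine eq_of_difference_eq (mul_left_cancel₀ hne ?_) (by rw [hB'.1.eval_zero, hB.eval_zero])
  rw [hB'.1.difference, hB.difference]

/-- The Bernoulli-like polynomial `B^B_{r,s}(x)`: the unique real polynomial with
`IsBernoulliLike r s`; see `isBernoulliLike_bernoulliLike` and `IsBernoulliLike.eq`. -/
noncomputable def bernoulliLike (r s : ℕ) : ℝ[X] :=
  (existsUnique_isBernoulliLike r s).choose

theorem isBernoulliLike_bernoulliLike (r s : ℕ) : IsBernoulliLike r s (bernoulliLike r s) :=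
  (existsUnique_isBernoulliLike r s).choose_spec.1.1

theorem natDegree_bernoulliLike_le (r s : ℕ) : (bernoulliLike r s).natDegree ≤ r + 2 * s :=
  (existsUnique_isBernoulliLike r s).choose_spec.1.2

theorem IsBernoulliLike.eq {r s : ℕ} {B : ℝ[X]} (hB : IsBernoulliLike r s B) :
    B = bernoulliLike r s := by
  have hne : ((X + 1) - (-X) : ℝ[X]) ≠ 0 := by
    intro h
    simpa using congrArg (Polynomial.eval (0 : ℝ)) h
  have h := isBernoulliLike_bernoulliLike r s
  refine eq_of_difference_eq (mul_left_cancel₀ hne ?_) (by rw [hB.eval_zero, h.eval_zero])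
  rw [hB.difference, h.difference]

end BernoulliLike

open MvPolynomial

/-- The algebra `S = ℝ[x_1, …, x_ℓ, z]` of polynomial functions on `V = ℝ^{ℓ+1}`. The variable
`some i` is `x_{i+1}` (for `i : Fin ℓ`, counted from zero) and the variable `none` is `z`. -/
abbrev S (ℓ : ℕ) : Type := MvPolynomial (Option (Fin ℓ)) ℝ

/-- The coordinate function `x_i`. -/
noncomputable def x {ℓ : ℕ} (i : Fin ℓ) : S ℓ := X (some i)

/-- The homogenizing coordinate `z`. -/
noncomputable def z (ℓ : ℕ) : S ℓ := X none

/-- `∂_i = ∂/∂x_i`. -/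
noncomputable def partialX {ℓ : ℕ} (i : Fin ℓ) : Derivation ℝ (S ℓ) (S ℓ) := pderiv (some i)

/-- `∂_z = ∂/∂z`. -/
noncomputable def partialZ (ℓ : ℕ) : Derivation ℝ (S ℓ) (S ℓ) := pderiv none

/-- The positive roots of type `B_ℓ`: `x_i` for all `i`, and `x_p + x_q`, `x_p - x_q` for
`p < q`, as linear forms in `S`. -/
def positiveRoots (ℓ : ℕ) : Set (S ℓ) :=
  {α | (∃ i : Fin ℓ, α = x i) ∨ ∃ p q : Fin ℓ, p < q ∧ (α = x p + x q ∨ α = x p - x q)}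

/-- The derivation module `D(S(B_ℓ))` of the cone `z ∏_{α > 0} α (α - z) = 0` over the Shi
arrangement of type `B_ℓ`: the derivations `θ` of `S` with `z ∣ θ(z)`, `α ∣ θ(α)` and
`α - z ∣ θ(α - z)` for every positive root `α`. -/
def derivationModule (ℓ : ℕ) : Submodule (S ℓ) (Derivation ℝ (S ℓ) (S ℓ)) where
  carrier := {θ | z ℓ ∣ θ (z ℓ) ∧
    ∀ α ∈ positiveRoots ℓ, α ∣ θ α ∧ (α - z ℓ) ∣ θ (α - z ℓ)}
  zero_mem' := ⟨by simp, fun α _ => ⟨by simp, by simp⟩⟩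
  add_mem' := fun {θ η} hθ hη => ⟨by
    rw [Derivation.add_apply]; exact dvd_add hθ.1 hη.1, fun α hα => ⟨by
      rw [Derivation.add_apply]; exact dvd_add (hθ.2 α hα).1 (hη.2 α hα).1, by
      rw [Derivation.add_apply]; exact dvd_add (hθ.2 α hα).2 (hη.2 α hα).2⟩⟩
  smul_mem' := fun c {θ} hθ => ⟨by
    rw [Derivation.smul_apply, smul_eq_mul]; exact hθ.1.mul_left c, fun α hα => ⟨by
      rw [Derivation.smul_apply, smul_eq_mul]; exact (hθ.2 α hα).1.mul_left c, by
      rw [Derivation.smul_apply, smul_eq_mul]; exact (hθ.2 α hα).2.mul_left c⟩⟩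

/-- The homogenization `z^{r+2s} B^B_{r,s}(x_i / z)`, an element of `S`. No term is lost, because
`B^B_{r,s}` has degree at most `r + 2s` (`natDegree_bernoulliLike_le`). -/
noncomputable def homogBernoulliLike {ℓ : ℕ} (r s : ℕ) (i : Fin ℓ) : S ℓ :=
  aeval ![x i, z ℓ] ((bernoulliLike r s).homogenize (r + 2 * s))

/-- The Euler derivation `θ_E = z ∂_z + ∑ x_i ∂_i`. -/
noncomputable def eulerDerivation (ℓ : ℕ) : Derivation ℝ (S ℓ) (S ℓ) :=
  z ℓ • partialZ ℓ + ∑ i : Fin ℓ, x i • partialX i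

/-- The coefficient of `∂_i` in `φ_j^B`, without the sign `(-1)^j`. With `j : Fin ℓ` counted from
zero, the usual index is `j + 1`, the set `{x_1, …, x_{j-1}}` is `Finset.Iio j` and
`{x_{j+1}, …, x_ℓ}` is `Finset.Ioi j`. The truncated subtraction in
`r = 2ℓ - 2(j+1) - k₂ - 2k₃ + 2` never truncates, since `k₂ ≤ 1` and `k₃ ≤ ℓ - (j+1)`. -/
noncomputable def phiCoeff {ℓ : ℕ} (j i : Fin ℓ) : S ℓ :=
  ∑ N ∈ ((Finset.Iio j).powerset ×ˢ (Finset.Iio j).powerset).filter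
      (fun N : Finset (Fin ℓ) × Finset (Fin ℓ) => Disjoint N.1 N.2),
    (∏ t ∈ N.1, x t ^ 2) * (∏ t ∈ N.2, (-(x t * z ℓ))) *
      ∑ k₂ ∈ Finset.range 2, ∑ k₃ ∈ Finset.range (ℓ - (j.val + 1) + 1),
        (-1) ^ (k₂ + k₃) *
          (({x j} : Multiset (S ℓ)).esymm k₂ *
            ((Finset.Ioi j).val.map (fun t => x t ^ 2)).esymm k₃) *
          homogBernoulliLike (2 * ℓ + 2 - 2 * (j.val + 1) - k₂ - 2 * k₃)
            (Finset.Iio j \ (N.1 ∪ N.2)).card i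

/-- The derivation `φ_{j+1}^B` (`j : Fin ℓ` is counted from zero). -/
noncomputable def phi {ℓ : ℕ} (j : Fin ℓ) : Derivation ℝ (S ℓ) (S ℓ) :=
  ((-1) ^ (j.val + 1) : S ℓ) • ∑ i : Fin ℓ, phiCoeff j i • partialX i

/-- A derivation of `S` is homogeneous of (polynomial) degree `d` if its coefficients, that is, its
values at all the coordinates, are homogeneous polynomials of degree `d`. -/
def IsHomogeneousDerivation {ℓ : ℕ} (θ : Derivation ℝ (S ℓ) (S ℓ)) (d : ℕ) : Prop :=
  ∀ v : Option (Fin ℓ), (θ (X v)).IsHomogeneous d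

end ShiB

/-! Up to sign, the coefficients of `φ_j` are the values `F_j(x_i)` of one polynomial `F_j(u)`,
called `phiValue`. Two properties of `F_j` carry the proof. It is odd in `u`, because each
Bernoulli-like polynomial is odd. It also satisfies a factored difference equation
(`phiValue_difference`): with `T_j(v) = v (v - x_j) ∏_{t>j} (v² - x_t²)`, `(2u + z)(F_j(u+z) -
F_j(u)) = z ∏_{t<j} (x_t + u)(x_t - u - z) · (T_j(u+z) - T_j(-u))`. The sums over `N_1, N_2` and
over `k_2, k_3` in `φ_j` are the expansions of these two products.

Membership (`phi_mem`): oddness gives `α ∣ φ_j(α)`. Modulo `α - z` the right side of the difference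
equation vanishes at the relevant `u`, and `2u + z` can be cancelled.

Basis, by Saito's argument: every `α` and `α - z` divides the determinant of the coefficient matrix.
These `2ℓ²` forms are pairwise coprime, and the determinant is homogeneous of degree `2ℓ · ℓ`. Being
nonzero (`det_phiMatrix_ne_zero`), it is a nonzero constant times their product. Cramer's rule then
expresses every derivation in the module that kills `z` through the `φ_j`, and `θ_E` accounts for
the value at `z`. -/

namespace ShiB
open MvPolynomial

/-! ### Homogenized Bernoulli-like polynomials: oddness and difference equation -/

section Homogenization

variable {R R' : Type*} [CommRing R] [Algebra ℝ R] [CommRing R'] [Algebra ℝ R']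

/-- The value `w^{r+2s} B^B_{r,s}(u / w)` in an arbitrary commutative `ℝ`-algebra. -/
noncomputable def homogValue (r s : ℕ) (u w : R) : R :=
  aeval ![u, w] ((bernoulliLike r s).homogenize (r + 2 * s))

theorem map_homogValue (g : R →ₐ[ℝ] R') (r s : ℕ) (u w : R) :
    g (homogValue r s u w) = homogValue r s (g u) (g w) := by
  have h : (g.comp (aeval ![u, w])) = aeval ![g u, g w] := by
    ext i; fin_cases i <;> simp
  exact congrArg (fun f => f ((bernoulliLike r s).homogenize (r + 2 * s))) h

theorem homogValue_real (r s : ℕ) (u : ℝ) {w : ℝ} (hw : w ≠ 0) :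
    homogValue r s u w = (bernoulliLike r s).eval (u / w) * w ^ (r + 2 * s) := by
  simpa [homogValue, aeval_eq_eval] using
    Polynomial.eval_homogenize (natDegree_bernoulliLike_le r s) ![u, w] hw

/-- An identity between values of bivariate polynomials holds in every `ℝ`-algebra if it holds
at all real points with nonzero second coordinate. -/
theorem aeval_eq_aeval_of_forall_real {p q : MvPolynomial (Fin 2) ℝ}
    (h : ∀ u w : ℝ, w ≠ 0 → eval ![u, w] p = eval ![u, w] q) (u w : R) :
    aeval ![u, w] p = aeval ![u, w] q := by
  -- The factor `X 1` makes both sides agree also where the second coordinate vanishes; it is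
  -- cancelled afterwards.
  have hpq : X 1 * p = X 1 * q := by
    refine MvPolynomial.funext fun v => ?_
    have hv : v = ![v 0, v 1] := by ext i; fin_cases i <;> rfl
    rw [eval_mul, eval_mul, eval_X]
    by_cases h1 : v 1 = 0
    · simp [h1]
    · rw [hv, h _ _ h1]
  rw [mul_left_cancel₀ (X_ne_zero 1) hpq]

theorem bernoulliLike_difference (r s : ℕ) (t : ℝ) :
    (2 * t + 1) * ((bernoulliLike r s).eval (t + 1) - (bernoulliLike r s).eval t) =
      ((t + 1) ^ r - (-t) ^ r) * ((t + 1) * (-t)) ^ s := by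
  have h := congrArg (Polynomial.eval t) (isBernoulliLike_bernoulliLike r s).difference
  simp only [Polynomial.eval_mul, Polynomial.eval_sub, Polynomial.eval_comp, Polynomial.eval_add,
    Polynomial.eval_X, Polynomial.eval_one, Polynomial.eval_pow, Polynomial.eval_neg] at h
  rw [mul_pow, ← h]
  ring

/-- The substitution `t ↦ -t - 1` swaps `t + 1` and `-t`, so `-B(-t)` solves the same difference
equation as `B`; uniqueness then makes `B` odd. -/
theorem bernoulliLike_comp_neg (r s : ℕ) :
    -(bernoulliLike r s).comp (-Polynomial.X) = bernoulliLike r s := by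
  refine IsBernoulliLike.eq ⟨?_, ?_⟩
  · refine Polynomial.funext fun t => ?_
    have h := bernoulliLike_difference r s (-t - 1)
    simp only [Polynomial.eval_mul, Polynomial.eval_sub, Polynomial.eval_comp, Polynomial.eval_add,
      Polynomial.eval_X, Polynomial.eval_one, Polynomial.eval_pow, Polynomial.eval_neg]
    rw [show -t - 1 + 1 = -t by ring, show -(-t - 1) = t + 1 by ring] at h
    rw [show -(t + 1) = -t - 1 by ring, ← mul_pow]
    rw [mul_comm (-t)] at h
    linear_combination -h
  · simp [(isBernoulliLike_bernoulliLike r s).eval_zero]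

theorem homogValue_neg (r s : ℕ) (u w : R) : homogValue r s (-u) w = -homogValue r s u w := by
  have h := aeval_eq_aeval_of_forall_real
    (p := homogValue r s (-X 0) (X 1)) (q := -homogValue r s (X 0) (X 1)) (fun u w hw => ?_) u w
  · simpa [map_homogValue] using h
  · have h0 : ∀ a b, eval ![u, w] (homogValue r s a b) =
        homogValue r s (eval ![u, w] a) (eval ![u, w] b) := fun a b => by
      simpa [aeval_eq_eval] using map_homogValue (aeval ![u, w]) r s a b
    have h1 := congrArg (Polynomial.eval (u / w)) (bernoulliLike_comp_neg r s)
    simp only [Polynomial.eval_comp, Polynomial.eval_neg, Polynomial.eval_X] at h1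
    simp only [map_neg, h0, eval_X, Matrix.cons_val_zero, Matrix.cons_val_one,
      homogValue_real r s _ hw]
    rw [neg_div, ← h1]
    ring

theorem homogValue_zero (r s : ℕ) (w : R) : homogValue r s 0 w = 0 := by
  have h := homogValue_neg r s 0 w
  rw [neg_zero] at h
  have h2 : (2 : ℝ) • homogValue r s 0 w = 0 := by rw [two_smul]; linear_combination h
  simpa using congrArg ((2 : ℝ)⁻¹ • ·) h2

theorem homogValue_difference (r s : ℕ) (u w : R) :
    (2 * u + w) * (homogValue r s (u + w) w - homogValue r s u w) =
      w * ((u + w) ^ r * ((u + w) * (-u)) ^ s - (-u) ^ r * ((u + w) * (-u)) ^ s) := by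
  have h := aeval_eq_aeval_of_forall_real
    (p := (2 * X 0 + X 1) * (homogValue r s (X 0 + X 1) (X 1) - homogValue r s (X 0) (X 1)))
    (q := X 1 * ((X 0 + X 1) ^ r * ((X 0 + X 1) * (-X 0)) ^ s -
      (-X 0) ^ r * ((X 0 + X 1) * (-X 0)) ^ s)) (fun u w hw => ?_) u w
  · simpa [map_homogValue] using h
  · have h0 : ∀ a b, eval ![u, w] (homogValue r s a b) =
        homogValue r s (eval ![u, w] a) (eval ![u, w] b) := fun a b => by
      simpa [aeval_eq_eval] using map_homogValue (aeval ![u, w]) r s a b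
    simp only [map_neg, map_mul, map_add, map_sub, map_pow, map_ofNat, h0, eval_X,
      Matrix.cons_val_zero, Matrix.cons_val_one, homogValue_real r s _ hw]
    -- With `t = u / w` this is the one-variable difference equation multiplied by `w^{r+2s+1}`.
    obtain ⟨t, rfl⟩ : ∃ t, u = t * w := ⟨u / w, by field_simp⟩
    have h1 := bernoulliLike_difference r s t
    rw [show (t * w + w) / w = t + 1 by field_simp, show t * w / w = t by field_simp,
      show t * w + w = (t + 1) * w by ring, show -(t * w) = -t * w by ring]
    simp only [mul_pow] at h1 ⊢
    linear_combination w ^ (r + 2 * s) * w * h1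

end Homogenization

/-! ### The generating polynomial of the coefficients of `φ_j` -/

section CoeffSum

variable {ℓ : ℕ} {R R' : Type*} [CommRing R] [CommRing R']

/-- The sum that defines `phiCoeff`, with arbitrary ring elements `y t`, `w`, `b r s` in place of
`x_t`, `z` and the homogenized Bernoulli-like polynomials. -/
noncomputable def coeffSum (j : Fin ℓ) (y : Fin ℓ → R) (w : R) (b : ℕ → ℕ → R) : R :=
  ∑ N ∈ ((Finset.Iio j).powerset ×ˢ (Finset.Iio j).powerset).filter
      (fun N : Finset (Fin ℓ) × Finset (Fin ℓ) => Disjoint N.1 N.2),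
    (∏ t ∈ N.1, y t ^ 2) * (∏ t ∈ N.2, (-(y t * w))) *
      ∑ k₂ ∈ Finset.range 2, ∑ k₃ ∈ Finset.range (ℓ - (j.val + 1) + 1),
        (-1) ^ (k₂ + k₃) *
          (({y j} : Multiset R).esymm k₂ *
            ((Finset.Ioi j).val.map (fun t => y t ^ 2)).esymm k₃) *
          b (2 * ℓ + 2 - 2 * (j.val + 1) - k₂ - 2 * k₃)
            (Finset.Iio j \ (N.1 ∪ N.2)).card

theorem coeffSum_sub (j : Fin ℓ) (y : Fin ℓ → R) (w : R) (b b' : ℕ → ℕ → R) :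
    coeffSum j y w (fun r s => b r s - b' r s) = coeffSum j y w b - coeffSum j y w b' := by
  simp only [coeffSum, mul_sub, Finset.sum_sub_distrib]

theorem coeffSum_mul_left (j : Fin ℓ) (y : Fin ℓ → R) (w c : R) (b : ℕ → ℕ → R) :
    coeffSum j y w (fun r s => c * b r s) = c * coeffSum j y w b := by
  simp only [coeffSum, Finset.mul_sum]
  refine Finset.sum_congr rfl fun N _ => Finset.sum_congr rfl fun k₂ _ =>
    Finset.sum_congr rfl fun k₃ _ => ?_
  ring

theorem map_multiset_esymm (g : R →+* R') (m : Multiset R) (k : ℕ) :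
    g (m.esymm k) = (m.map g).esymm k := by
  simp only [Multiset.esymm, Multiset.powersetCard_map, Multiset.map_map, map_multiset_sum,
    Function.comp_def, map_multiset_prod]

theorem map_coeffSum [Algebra ℝ R] [Algebra ℝ R'] (g : R →ₐ[ℝ] R') (j : Fin ℓ) (y : Fin ℓ → R) (w : R) (b : ℕ → ℕ → R) :
    g (coeffSum j y w b) = coeffSum j (fun t => g (y t)) (g w) (fun r s => g (b r s)) := by
  have h : ∀ m k, g (Multiset.esymm m k) = (m.map g).esymm k := fun m k =>
    map_multiset_esymm (g : R →+* R') m k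
  simp only [coeffSum, map_sum, map_mul, map_prod, map_pow, map_neg, map_one, h,
    Multiset.map_map, Function.comp_def, Multiset.map_singleton]

/-- Expanding the product amounts to choosing `f`, `g` or `c` at each index; the disjoint sets
`N.1`, `N.2` record where `f` and `g` are chosen. -/
theorem sum_disjoint_prod {ι : Type*} [DecidableEq ι] (s : Finset ι) (f g : ι → R) (c : R) :
    ∑ N ∈ (s.powerset ×ˢ s.powerset).filter
        (fun N : Finset ι × Finset ι => Disjoint N.1 N.2),
      (∏ t ∈ N.1, f t) * (∏ t ∈ N.2, g t) * c ^ (s \ (N.1 ∪ N.2)).card =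
    ∏ t ∈ s, (f t + g t + c) := by
  have h : ∏ t ∈ s, (f t + g t + c) = ∏ t ∈ s, (f t + (g t + c)) :=
    Finset.prod_congr rfl fun t _ => by ring
  rw [h, Finset.prod_add, Finset.sum_filter, Finset.sum_product]
  refine Finset.sum_congr rfl fun N hN => ?_
  rw [Finset.prod_add, Finset.mul_sum, ← Finset.sum_filter]
  refine Finset.sum_congr ?_ fun M _ => ?_
  · ext M
    simp only [Finset.mem_filter, Finset.mem_powerset, Finset.subset_sdiff, disjoint_comm]
  · rw [Finset.prod_const, sdiff_sdiff_left, mul_assoc, Finset.sup_eq_union]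

theorem sum_esymm_mul_pow (m : Multiset R) (v : R) :
    ∑ k ∈ Finset.range (m.card + 1), (-1) ^ k * m.esymm k * v ^ (m.card - k) =
      (m.map fun t => v - t).prod := by
  have h := congrArg (Polynomial.eval v) (Multiset.prod_X_sub_X_eq_sum_esymm m)
  simp only [Polynomial.eval_multiset_prod, Multiset.map_map, Function.comp_def,
    Polynomial.eval_finsetSum, Polynomial.eval_mul, Polynomial.eval_pow, Polynomial.eval_neg,
    Polynomial.eval_one, Polynomial.eval_C, Polynomial.eval_X, Polynomial.eval_sub] at h
  rw [h]
  exact Finset.sum_congr rfl fun k _ => by ring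

/-- The factor `v (v - y_j) ∏_{t > j} (v² - y_t²)`. -/
def tailFactor (j : Fin ℓ) (y : Fin ℓ → R) (v : R) : R :=
  v * (v - y j) * ∏ t ∈ Finset.Ioi j, (v ^ 2 - y t ^ 2)

/-- On `b r s = v^r c^s` the sum splits: the disjoint pairs give the product over `t < j`, and the
elementary symmetric polynomials give `tailFactor` by Vieta. Since `coeffSum` is linear in `b`, this
handles the right side of `homogValue_difference`. -/
theorem coeffSum_pow (j : Fin ℓ) (y : Fin ℓ → R) (w v c : R) :
    coeffSum j y w (fun r s => v ^ r * c ^ s) =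
      (∏ t ∈ Finset.Iio j, (y t ^ 2 - y t * w + c)) * tailFactor j y v := by
  have hT : ∑ k₂ ∈ Finset.range 2, ∑ k₃ ∈ Finset.range (ℓ - (j.val + 1) + 1),
      (-1) ^ (k₂ + k₃) * (({y j} : Multiset R).esymm k₂ *
        ((Finset.Ioi j).val.map (fun t => y t ^ 2)).esymm k₃) *
          v ^ (2 * ℓ + 2 - 2 * (j.val + 1) - k₂ - 2 * k₃) = tailFactor j y v := by
    have h1 := sum_esymm_mul_pow ((Finset.Ioi j).val.map (fun t => y t ^ 2)) (v ^ 2)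
    have hc : ((Finset.Ioi j).val.map (fun t => y t ^ 2)).card = ℓ - (j.val + 1) := by
      rw [Multiset.card_map, Finset.card_val, Fin.card_Ioi]; omega
    rw [hc, Multiset.map_map] at h1
    have h2 : ∏ t ∈ Finset.Ioi j, (v ^ 2 - y t ^ 2) =
      (((Finset.Ioi j).val.map ((fun t => v ^ 2 - t) ∘ fun t => y t ^ 2)).prod) := rfl
    have e0 : ({y j} : Multiset R).esymm 0 = 1 := by simp [Multiset.esymm]
    have e1 : ({y j} : Multiset R).esymm 1 = y j := by
      simp [Multiset.esymm, Multiset.powersetCard_one]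
    rw [tailFactor, h2, ← h1, Finset.sum_range_succ, Finset.sum_range_one, e0, e1,
      Finset.mul_sum, ← Finset.sum_add_distrib]
    refine Finset.sum_congr rfl fun k hk => ?_
    have hk := Finset.mem_range.1 hk
    have hj := j.isLt
    rw [show 2 * ℓ + 2 - 2 * (j.val + 1) - 0 - 2 * k = 2 * (ℓ - (j.val + 1) - k) + 2 by omega,
      show 2 * ℓ + 2 - 2 * (j.val + 1) - 1 - 2 * k = 2 * (ℓ - (j.val + 1) - k) + 1 by omega]
    ring
  rw [← hT, ← Finset.prod_congr rfl fun t _ =>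
    show y t ^ 2 + -(y t * w) + c = y t ^ 2 - y t * w + c by ring, ← sum_disjoint_prod,
    Finset.sum_mul, coeffSum]
  refine Finset.sum_congr rfl fun N _ => ?_
  simp only [Finset.mul_sum]
  refine Finset.sum_congr rfl fun k₂ _ => Finset.sum_congr rfl fun k₃ _ => ?_
  ring

/-- The common generating polynomial of the coefficients of `φ_j`, evaluated at `u`. -/
noncomputable def phiValue [Algebra ℝ R] (j : Fin ℓ) (y : Fin ℓ → R) (w u : R) : R :=
  coeffSum j y w fun r s => homogValue r s u w

theorem phiCoeff_eq_phiValue (j i : Fin ℓ) : phiCoeff j i = phiValue j x (z ℓ) (x i) := rfl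

theorem map_phiValue [Algebra ℝ R] [Algebra ℝ R'] (g : R →ₐ[ℝ] R') (j : Fin ℓ) (y : Fin ℓ → R) (w u : R) :
    g (phiValue j y w u) = phiValue j (fun t => g (y t)) (g w) (g u) := by
  simp only [phiValue, map_coeffSum, map_homogValue]

theorem phiValue_neg [Algebra ℝ R] (j : Fin ℓ) (y : Fin ℓ → R) (w u : R) :
    phiValue j y w (-u) = -phiValue j y w u := by
  have h := coeffSum_mul_left j y w (-1) fun r s => homogValue r s u w
  simpa only [phiValue, homogValue_neg, neg_one_mul] using h

theorem phiValue_zero [Algebra ℝ R] (j : Fin ℓ) (y : Fin ℓ → R) (w : R) : phiValue j y w 0 = 0 := by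
  simp [phiValue, homogValue_zero, coeffSum]

/-- Here `coeffSum_pow` is applied with `c = (u + w)(-u)`, for which `y² - y w + c = (y + u)(y - u -
w)`. -/
theorem phiValue_difference [Algebra ℝ R] (j : Fin ℓ) (y : Fin ℓ → R) (w u : R) :
    (2 * u + w) * (phiValue j y w (u + w) - phiValue j y w u) =
      w * ((∏ t ∈ Finset.Iio j, ((y t + u) * (y t - u - w))) *
        (tailFactor j y (u + w) - tailFactor j y (-u))) := by
  rw [phiValue, phiValue, ← coeffSum_sub, ← coeffSum_mul_left]
  simp only [homogValue_difference]
  rw [coeffSum_mul_left, coeffSum_sub, coeffSum_pow, coeffSum_pow, ← mul_sub]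
  congr 2
  exact Finset.prod_congr rfl fun t _ => by ring

theorem tailFactor_eq_zero {j p : Fin ℓ} (hp : j ≤ p) (y : Fin ℓ → R) :
    tailFactor j y (y p) = 0 := by
  rcases hp.eq_or_lt with rfl | hp
  · simp [tailFactor]
  · rw [tailFactor, Finset.prod_eq_zero (Finset.mem_Ioi.2 hp) (sub_self _), mul_zero]

theorem tailFactor_neg_eq_zero {j p : Fin ℓ} (hp : j < p) (y : Fin ℓ → R) :
    tailFactor j y (-y p) = 0 := by
  rw [tailFactor, Finset.prod_eq_zero (Finset.mem_Ioi.2 hp) (by ring), mul_zero]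

theorem tailFactor_zero (j : Fin ℓ) (y : Fin ℓ → R) : tailFactor j y 0 = 0 := by
  simp [tailFactor]

theorem phiValue_eq_zero_of_eq [IsDomain R] [Algebra ℝ R] (j i : Fin ℓ) (y : Fin ℓ → R) {w : R} (hw : w ≠ 0)
    (h : y i = w) : phiValue j y w (y i) = 0 := by
  -- At `u = 0` the term `F_j(0)` drops out and `2u + w` becomes `w`.
  have hd := phiValue_difference j y w 0
  rw [phiValue_zero, mul_zero, zero_add, sub_zero, neg_zero, tailFactor_zero,
    sub_zero] at hd
  have h0 := mul_left_cancel₀ hw hd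
  rw [h, h0]
  rcases lt_or_ge i j with hij | hij
  · rw [Finset.prod_eq_zero (Finset.mem_Iio.2 hij) (by rw [h]; ring), zero_mul]
  · rw [← h, tailFactor_eq_zero hij, mul_zero]

/-- Take `u = y q`. If `p < j`, the factor `y p - u - w` vanishes. Otherwise `p ≥ j` is a root of
the first tail factor, and `q > p` is strictly beyond `j`, so the second one vanishes at `-y q`; at
`-y j` it need not. -/
theorem phiValue_sub_eq_zero [IsDomain R] [Algebra ℝ R] (j : Fin ℓ) {p q : Fin ℓ} (hpq : p < q)
    (y : Fin ℓ → R) {w : R} (hw : 2 * y q + w ≠ 0) (h : y p = y q + w) :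
    phiValue j y w (y p) - phiValue j y w (y q) = 0 := by
  refine (mul_eq_zero.1 ?_).resolve_left hw
  rw [h, phiValue_difference]
  rcases lt_or_ge p j with hj | hj
  · rw [Finset.prod_eq_zero (Finset.mem_Iio.2 hj) (by rw [h]; ring), zero_mul, mul_zero]
  · rw [← h, tailFactor_eq_zero hj, tailFactor_neg_eq_zero (hj.trans_lt hpq), sub_zero, mul_zero,
      mul_zero]

/-- By oddness the sum is a difference with `u = -y q`; both tail factors are then evaluated at `y
p` and `y q`. -/
theorem phiValue_add_eq_zero [IsDomain R] [Algebra ℝ R] (j : Fin ℓ) {p q : Fin ℓ} (hpq : p < q)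
    (y : Fin ℓ → R) {w : R} (hw : 2 * -y q + w ≠ 0) (h : y p = -y q + w) :
    phiValue j y w (y p) + phiValue j y w (y q) = 0 := by
  refine (mul_eq_zero.1 ?_).resolve_left hw
  rw [← sub_neg_eq_add (phiValue j y w (y p)), ← phiValue_neg, h, phiValue_difference]
  rcases lt_or_ge p j with hj | hj
  · rw [Finset.prod_eq_zero (Finset.mem_Iio.2 hj) (by rw [h]; ring), zero_mul, mul_zero]
  · rw [← h, neg_neg, tailFactor_eq_zero hj, tailFactor_eq_zero (hj.trans hpq.le), sub_zero,
      mul_zero, mul_zero]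

end CoeffSum

/-! ### Linear forms: primality and divisibility -/

section LinearForm

variable {σ : Type*}

theorem isHomogeneous_sumSMulX (v : σ →₀ ℝ) : (sumSMulX v).IsHomogeneous 1 := by
  rw [sumSMulX, Finsupp.linearCombination_apply, Finsupp.sum]
  refine IsHomogeneous.sum _ _ _ fun i _ => ?_
  rw [smul_eq_C_mul]
  exact isHomogeneous_C_mul_X _ _

theorem sumSMulX_ne_zero {v : σ →₀ ℝ} (hv : v ≠ 0) : sumSMulX v ≠ 0 := by
  obtain ⟨i, hi⟩ := Finsupp.ne_iff.1 hv
  intro h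
  apply hi
  simpa [h] using (coeff_sumSMulX v i).symm

theorem totalDegree_sumSMulX {v : σ →₀ ℝ} (hv : v ≠ 0) : (sumSMulX v).totalDegree = 1 :=
  (isHomogeneous_sumSMulX v).totalDegree (sumSMulX_ne_zero hv)

theorem prime_sumSMulX {v : σ →₀ ℝ} (hv : v ≠ 0) : Prime (sumSMulX v) := by
  refine (irreducible_sumSMulX v (Finsupp.support_nonempty_iff.2 hv) fun r hr => ?_).prime
  obtain ⟨i, hi⟩ := Finsupp.ne_iff.1 hv
  exact (ne_zero_of_dvd_ne_zero hi (hr i)).isUnit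

theorem exists_smul_eq_of_sumSMulX_dvd {v w : σ →₀ ℝ} (hw : w ≠ 0)
    (h : sumSMulX v ∣ sumSMulX w) : ∃ c : ℝ, ∀ i, w i = c * v i := by
  obtain ⟨f, hf⟩ := h
  have hne : sumSMulX v * f ≠ 0 := hf ▸ sumSMulX_ne_zero hw
  have hv : v ≠ 0 := by
    rintro rfl
    simp at hne
  have hd := congrArg totalDegree hf
  rw [totalDegree_mul_of_isDomain (left_ne_zero_of_mul hne) (right_ne_zero_of_mul hne),
    totalDegree_sumSMulX hw, totalDegree_sumSMulX hv] at hd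
  have hC := totalDegree_eq_zero_iff_eq_C.1 (show f.totalDegree = 0 by omega)
  refine ⟨coeff 0 f, fun i => ?_⟩
  classical
  rw [← coeff_sumSMulX w, hf, hC, mul_comm, coeff_C_mul, coeff_sumSMulX, coeff_C, if_pos rfl]

theorem not_sumSMulX_dvd {v w : σ →₀ ℝ} {k m : σ} (hv : v k ≠ 0) (hw : w k = 0) (hm : w m ≠ 0) :
    ¬ sumSMulX v ∣ sumSMulX w := by
  intro h
  obtain ⟨c, hc⟩ := exists_smul_eq_of_sumSMulX_dvd (fun h0 => hm (by simp [h0])) h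
  have h1 := hc k
  rw [hw] at h1
  have hc0 : c = 0 := (mul_eq_zero.1 h1.symm).resolve_right hv
  exact hm (by rw [hc, hc0, zero_mul])

theorem sumSMulX_single (k : σ) (c : ℝ) : sumSMulX (Finsupp.single k c) = C c * X k := by
  rw [sumSMulX, Finsupp.linearCombination_single, smul_eq_C_mul]

end LinearForm

variable {ℓ : ℕ}

/-! ### Membership of the `φ_j` in the derivation module -/

theorem derivation_sum_apply {ι A M : Type*} [CommRing A] [Algebra ℝ A] [AddCommGroup M]
    [Module A M] [Module ℝ M] (s : Finset ι) (D : ι → Derivation ℝ A M) (a : A) :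
    (∑ i ∈ s, D i) a = ∑ i ∈ s, D i a := by
  rw [← Finset.sum_apply a s fun i => (D i : A → M)]
  exact congrFun (map_sum (Derivation.coeFnAddMonoidHom (R := ℝ) (A := A) (M := M)) D s) a

theorem phi_x (j i : Fin ℓ) : phi j (x i) = (-1) ^ (j.val + 1) * phiValue j x (z ℓ) (x i) := by
  simp only [phi, Derivation.smul_apply, derivation_sum_apply, partialX, x,
    smul_eq_mul, phiCoeff_eq_phiValue]
  congr 1
  rw [Finset.sum_eq_single i (fun k _ hk => ?_) (by simp)]
  · simp
  · rw [pderiv_X_of_ne (by simpa using hk.symm), mul_zero]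

theorem phi_z (j : Fin ℓ) : phi j (z ℓ) = 0 := by
  simp only [phi, Derivation.smul_apply, derivation_sum_apply, partialX, z,
    smul_eq_mul]
  rw [Finset.sum_eq_zero fun k _ => by rw [pderiv_X_of_ne (by simp), mul_zero], mul_zero]

/-- Divisibility by a prime is vanishing in the quotient domain, where `β = 0` becomes an equation
between coordinates and factors can be cancelled. -/
theorem dvd_of_forall_hom {β : S ℓ} (hβ : Prime β) {f : S ℓ}
    (h : ∀ (R : Type) [CommRing R] [IsDomain R] [Algebra ℝ R] (g : S ℓ →ₐ[ℝ] R),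
      (∀ p, g p = 0 ↔ β ∣ p) → g f = 0) : β ∣ f := by
  have : (Ideal.span {β}).IsPrime := (Ideal.span_singleton_prime hβ.ne_zero).2 hβ
  have hg : ∀ p, Ideal.Quotient.mkₐ ℝ (Ideal.span {β}) p = 0 ↔ β ∣ p := fun p => by
    rw [Ideal.Quotient.mkₐ_eq_mk, Ideal.Quotient.eq_zero_iff_mem, Ideal.mem_span_singleton]
  exact (hg f).1 (h _ (Ideal.Quotient.mkₐ ℝ (Ideal.span {β})) hg)

theorem phi_mem (j : Fin ℓ) : phi j ∈ derivationModule ℓ := by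
  classical
  refine ⟨by simp [phi_z], fun α hα => ?_⟩
  rw [map_sub, phi_z, sub_zero]
  rcases hα with ⟨i, rfl⟩ | ⟨p, q, hpq, rfl | rfl⟩
  · rw [phi_x]
    have e1 : x i = sumSMulX (Finsupp.single (some i) 1) := by simp [sumSMulX_single, x]
    have e2 : x i - z ℓ = sumSMulX (Finsupp.single (some i) 1 - Finsupp.single none 1) := by
      simp [sumSMulX_single, x, z, map_sub]
    have e3 : z ℓ = sumSMulX (Finsupp.single none 1) := by simp [sumSMulX_single, z]
    refine ⟨Dvd.dvd.mul_left (dvd_of_forall_hom ?_ fun R _ _ _ g hg => ?_) _,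
      Dvd.dvd.mul_left (dvd_of_forall_hom ?_ fun R _ _ _ g hg => ?_) _⟩
    · rw [e1]
      exact prime_sumSMulX (by simp)
    · rw [map_phiValue, (hg _).2 dvd_rfl, phiValue_zero]
    · rw [e2]
      exact prime_sumSMulX (Finsupp.ne_iff.2 ⟨some i, by simp⟩)
    · rw [map_phiValue]
      refine phiValue_eq_zero_of_eq j i _ (fun h => ?_)
        (sub_eq_zero.1 (by rw [← map_sub, hg]))
      -- If `z` vanished in the quotient, `x_i - z` would divide `z`, in which `x_i` does not occur.
      rw [hg, e2, e3] at h
      exact not_sumSMulX_dvd (k := some i) (m := none) (by simp) (by simp) (by simp) h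
  · rw [map_add, phi_x, phi_x, ← mul_add]
    have e1 : x p + x q =
        sumSMulX (Finsupp.single (some p) 1 + Finsupp.single (some q) 1) := by
      simp [sumSMulX_single, x]
    have e2 : x p + x q - z ℓ = sumSMulX (Finsupp.single (some p) 1 +
        Finsupp.single (some q) 1 - Finsupp.single none 1) := by
      simp [sumSMulX_single, x, z]
    have e3 : 2 * -x q + z ℓ =
        sumSMulX (Finsupp.single (some q) (-2) + Finsupp.single none 1) := by
      simp [sumSMulX_single, x, z, ← map_ofNat C 2]
    refine ⟨Dvd.dvd.mul_left (dvd_of_forall_hom ?_ fun R _ _ _ g hg => ?_) _,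
      Dvd.dvd.mul_left (dvd_of_forall_hom ?_ fun R _ _ _ g hg => ?_) _⟩
    · rw [e1]
      exact prime_sumSMulX (Finsupp.ne_iff.2 ⟨some p, by simp [hpq.ne]⟩)
    · have h : g (x p) = -g (x q) := eq_neg_of_add_eq_zero_left (by rw [← map_add, hg])
      rw [map_add, map_phiValue, map_phiValue, h, phiValue_neg, neg_add_cancel]
    · rw [e2]
      exact prime_sumSMulX (Finsupp.ne_iff.2 ⟨some p, by simp [hpq.ne]⟩)
    · have h0 : g (x p) + g (x q) - g (z ℓ) = 0 := by rw [← map_add, ← map_sub, hg]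
      rw [map_add, map_phiValue, map_phiValue]
      refine phiValue_add_eq_zero j hpq (fun t => g (x t)) (fun h => ?_)
        (by linear_combination h0)
      -- The factor `2u + z` at `u = -x_q` survives in the quotient: it does not involve `x_p`,
      -- whereas `x_p + x_q - z` does.
      have h' : g (2 * -x q + z ℓ) = 0 := by rwa [map_add, map_mul, map_neg, map_ofNat]
      rw [hg, e2, e3] at h'
      exact not_sumSMulX_dvd (k := some p) (m := none) (by simp [hpq.ne])
        (by simp [hpq.ne]) (by simp) h'
  · rw [map_sub, phi_x, phi_x, ← mul_sub]
    have e1 : x p - x q =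
        sumSMulX (Finsupp.single (some p) 1 - Finsupp.single (some q) 1) := by
      simp [sumSMulX_single, x]
    have e2 : x p - x q - z ℓ = sumSMulX (Finsupp.single (some p) 1 -
        Finsupp.single (some q) 1 - Finsupp.single none 1) := by
      simp [sumSMulX_single, x, z]
    have e3 : 2 * x q + z ℓ =
        sumSMulX (Finsupp.single (some q) 2 + Finsupp.single none 1) := by
      simp [sumSMulX_single, x, z, ← map_ofNat C 2]
    refine ⟨Dvd.dvd.mul_left (dvd_of_forall_hom ?_ fun R _ _ _ g hg => ?_) _,
      Dvd.dvd.mul_left (dvd_of_forall_hom ?_ fun R _ _ _ g hg => ?_) _⟩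
    · rw [e1]
      exact prime_sumSMulX (Finsupp.ne_iff.2 ⟨some p, by simp [hpq.ne]⟩)
    · have h : g (x p) = g (x q) := sub_eq_zero.1 (by rw [← map_sub, hg])
      rw [map_sub, map_phiValue, map_phiValue, h, sub_self]
    · rw [e2]
      exact prime_sumSMulX (Finsupp.ne_iff.2 ⟨some p, by simp [hpq.ne]⟩)
    · have h0 : g (x p) - g (x q) - g (z ℓ) = 0 := by rw [← map_sub, ← map_sub, hg]
      rw [map_sub, map_phiValue, map_phiValue]
      refine phiValue_sub_eq_zero j hpq (fun t => g (x t)) (fun h => ?_)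
        (by linear_combination h0)
      have h' : g (2 * x q + z ℓ) = 0 := by rwa [map_add, map_mul, map_ofNat]
      rw [hg, e2, e3] at h'
      exact not_sumSMulX_dvd (k := some p) (m := none) (by simp [hpq.ne])
        (by simp [hpq.ne]) (by simp) h'

/-! ### The `2ℓ²` forms `α`, `α - z` and their product -/

/-- The coefficient of the second coordinate in the positive root indexed by a pair: `(p, q)`
stands for `x_p - x_q` if `p < q`, for `x_p` if `p = q` and for `x_q + x_p` if `q < p`. -/
def rootSign (a : Fin ℓ × Fin ℓ) : ℝ := if a.1 < a.2 then -1 else if a.1 = a.2 then 0 else 1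

/-- The coefficient vector of the positive root indexed by a pair. -/
noncomputable def rootVec (a : Fin ℓ × Fin ℓ) : Fin ℓ → ℝ := fun k =>
  (if k = min a.1 a.2 then 1 else 0) + if k = max a.1 a.2 then rootSign a else 0

/-- The coefficient vectors of the linear forms `α` and `α - z`, for `α` a positive root. -/
noncomputable def formVec (a : (Fin ℓ × Fin ℓ) × Bool) : Option (Fin ℓ) →₀ ℝ :=
  Finsupp.equivFunOnFinite.symm fun k =>
    k.elim (if a.2 then -1 else 0) (rootVec a.1)

theorem formVec_some (a : (Fin ℓ × Fin ℓ) × Bool) (k : Fin ℓ) :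
    formVec a (some k) = rootVec a.1 k := rfl

theorem formVec_none (a : (Fin ℓ × Fin ℓ) × Bool) :
    formVec a none = if a.2 then -1 else 0 := rfl

theorem rootVec_min (a : Fin ℓ × Fin ℓ) : rootVec a (min a.1 a.2) = 1 := by
  unfold rootVec rootSign
  grind

theorem formVec_ne_zero (a : (Fin ℓ × Fin ℓ) × Bool) : formVec a ≠ 0 :=
  Finsupp.ne_iff.2 ⟨some (min a.1.1 a.1.2), by rw [formVec_some, rootVec_min]; simp⟩

theorem rootVec_of_lt {a : Fin ℓ × Fin ℓ} {k : Fin ℓ} (h : k < min a.1 a.2) : rootVec a k = 0 := by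
  unfold rootVec
  grind

theorem rootVec_injective : Function.Injective (rootVec (ℓ := ℓ)) := by
  intro a b h
  have h1 : min a.1 a.2 = min b.1 b.2 := by
    rcases lt_trichotomy (min a.1 a.2) (min b.1 b.2) with hlt | heq | hlt
    · have := congrFun h (min a.1 a.2)
      rw [rootVec_min, rootVec_of_lt hlt] at this
      norm_num at this
    · exact heq
    · have := congrFun h (min b.1 b.2)
      rw [rootVec_min, rootVec_of_lt hlt] at this
      norm_num at this
  have h2 := congrFun h (max a.1 a.2)
  have h3 := congrFun h (max b.1 b.2)
  obtain ⟨a1, a2⟩ := a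
  obtain ⟨b1, b2⟩ := b
  simp only [rootVec, rootSign] at h1 h2 h3 ⊢
  grind

/-- Divisibility makes the coefficient vectors proportional. The first nonzero coefficient of each
is `1`, so the ratio is `1`. -/
theorem eq_of_formVec_dvd {a b : (Fin ℓ × Fin ℓ) × Bool}
    (h : sumSMulX (formVec a) ∣ sumSMulX (formVec b)) : a = b := by
  obtain ⟨c, hc⟩ := exists_smul_eq_of_sumSMulX_dvd (formVec_ne_zero b) h
  have hr : ∀ k, rootVec b.1 k = c * rootVec a.1 k := fun k => hc (some k)
  have hc1 : c = 1 := by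
    rcases lt_trichotomy (min a.1.1 a.1.2) (min b.1.1 b.1.2) with hlt | heq | hlt
    · have h1 := hr (min a.1.1 a.1.2)
      have h2 := hr (min b.1.1 b.1.2)
      rw [rootVec_min, rootVec_of_lt hlt, mul_one] at h1
      rw [rootVec_min, ← h1, zero_mul] at h2
      norm_num at h2
    · have h1 := hr (min a.1.1 a.1.2)
      rw [rootVec_min, heq, rootVec_min, mul_one] at h1
      exact h1.symm
    · have h2 := hr (min b.1.1 b.1.2)
      rw [rootVec_min, rootVec_of_lt hlt, mul_zero] at h2
      norm_num at h2
  refine Prod.ext (rootVec_injective (funext fun k => ?_)) ?_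
  · rw [hr, hc1, one_mul]
  · have h3 := hc none
    rw [formVec_none, formVec_none, hc1] at h3
    cases ha : a.2 <;> cases hb : b.2 <;> simp [ha, hb] at h3 ⊢

theorem sumSMulX_formVec (a : (Fin ℓ × Fin ℓ) × Bool) :
    sumSMulX (formVec a) =
      ∑ k, C (rootVec a.1 k) * x k - if a.2 then z ℓ else 0 := by
  rw [sumSMulX, Finsupp.linearCombination_apply, Finsupp.sum_fintype _ _ (by simp),
    Fintype.sum_option, formVec_none]
  simp only [formVec_some, smul_eq_C_mul, x, z]
  split_ifs <;> simp [add_comm, sub_eq_add_neg]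

theorem sum_rootVec_mem (a : Fin ℓ × Fin ℓ) :
    ∑ k, C (rootVec a k) * x k ∈ positiveRoots ℓ := by
  have h : ∑ k, C (rootVec a k) * x k =
      x (min a.1 a.2) + C (rootSign a) * x (max a.1 a.2) := by
    simp only [rootVec, map_add, add_mul, Finset.sum_add_distrib, apply_ite C, map_zero, map_one,
      ite_mul, zero_mul, one_mul, Finset.sum_ite_eq', Finset.mem_univ, if_true]
  rw [h]
  rcases lt_trichotomy a.1 a.2 with hlt | heq | hlt
  · refine Or.inr ⟨a.1, a.2, hlt, Or.inr ?_⟩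
    simp [rootSign, hlt, hlt.le, sub_eq_add_neg]
  · refine Or.inl ⟨a.1, ?_⟩
    simp [rootSign, heq]
  · refine Or.inr ⟨a.2, a.1, hlt, Or.inl ?_⟩
    simp [rootSign, hlt.not_gt, hlt.ne', hlt.le]

/-- The product of all linear forms `α` and `α - z`. -/
noncomputable def affineProduct (ℓ : ℕ) : S ℓ :=
  ∏ a : (Fin ℓ × Fin ℓ) × Bool, sumSMulX (formVec a)

theorem affineProduct_ne_zero : affineProduct ℓ ≠ 0 :=
  Finset.prod_ne_zero_iff.2 fun a _ => sumSMulX_ne_zero (formVec_ne_zero a)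

theorem isHomogeneous_affineProduct : (affineProduct ℓ).IsHomogeneous (2 * ℓ * ℓ) := by
  have h := IsHomogeneous.prod Finset.univ (fun a : (Fin ℓ × Fin ℓ) × Bool => sumSMulX (formVec a))
    (fun _ => 1) fun a _ => isHomogeneous_sumSMulX _
  have hc : ∑ _a : (Fin ℓ × Fin ℓ) × Bool, 1 = 2 * ℓ * ℓ := by
    simp
    ring
  rwa [hc] at h

/-- The form `α` or `α - z` divides every value at `α` of a derivation in `D` that kills `z`. -/
theorem formVec_dvd_apply {θ : Derivation ℝ (S ℓ) (S ℓ)} (hθ : θ ∈ derivationModule ℓ)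
    (hz : θ (z ℓ) = 0) (a : (Fin ℓ × Fin ℓ) × Bool) :
    sumSMulX (formVec a) ∣ ∑ k, C (rootVec a.1 k) * θ (x k) := by
  have h := hθ.2 _ (sum_rootVec_mem a.1)
  have hs : θ (∑ k, C (rootVec a.1 k) * x k) = ∑ k, C (rootVec a.1 k) * θ (x k) := by
    rw [map_sum]
    exact Finset.sum_congr rfl fun k _ => by
      rw [← smul_eq_C_mul, Derivation.map_smul, smul_eq_C_mul]
  rw [map_sub, hz, sub_zero, hs] at h
  rw [sumSMulX_formVec]
  split_ifs
  · exact h.2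
  · rw [sub_zero]
    exact h.1

/-- The forms are pairwise non-associated primes, so each may be treated alone. The combination of
rows with the coefficients of `α` is divisible by the form; multiplying by the adjugate turns it
into `det` times those coefficients, one of which is `1`. -/
theorem affineProduct_dvd_det {N : Matrix (Fin ℓ) (Fin ℓ) (S ℓ)}
    (hN : ∀ j, ∃ θ ∈ derivationModule ℓ, θ (z ℓ) = 0 ∧ ∀ i, N i j = θ (x i)) :
    affineProduct ℓ ∣ N.det := by
  refine Finset.prod_dvd_of_isRelPrime (fun a _ b _ hab => ?_) fun a _ => ?_
  · exact (prime_sumSMulX (formVec_ne_zero a)).irreducible.isRelPrime_iff_not_dvd.2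
      fun h => hab (eq_of_formVec_dvd h)
  · have hv : ∀ j, sumSMulX (formVec a) ∣
        Matrix.vecMul (fun k => C (rootVec a.1 k)) N j := fun j => by
      obtain ⟨θ, hθ, hz, hi⟩ := hN j
      simpa [Matrix.vecMul, dotProduct, hi] using formVec_dvd_apply hθ hz a
    have h := congrFun (Matrix.vecMul_vecMul (fun k => (C (rootVec a.1 k) : S ℓ)) N N.adjugate)
      (min a.1.1 a.1.2)
    rw [Matrix.mul_adjugate, Matrix.vecMul_smul, Matrix.vecMul_one, Pi.smul_apply, rootVec_min,
      C_1, smul_eq_mul, mul_one] at h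
    rw [← h]
    rw [Matrix.vecMul, dotProduct]
    exact Finset.dvd_sum fun j _ => (hv j).mul_right _

/-! ### Degrees -/

section Degree

theorem isHomogeneous_esymm_map {σ ι : Type*} (s : Finset ι) {f : ι → MvPolynomial σ ℝ} {d : ℕ}
    (hf : ∀ i, (f i).IsHomogeneous d) (k : ℕ) : ((s.val.map f).esymm k).IsHomogeneous (d * k) := by
  rw [Finset.esymm_map_val]
  refine IsHomogeneous.sum _ _ _ fun t ht => ?_
  have h := IsHomogeneous.prod t f (fun _ => d) fun i _ => hf i
  rwa [Finset.sum_const, (Finset.mem_powersetCard.1 ht).2, smul_eq_mul, mul_comm] at h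

/-- The three sets `N.1`, `N.2` and their complement partition `Iio j` and contribute degree `2` per
element; the remaining degree is `2 (ℓ - j)` with `j` counted from zero. -/
theorem phiCoeff_degree_identity {j : Fin ℓ} {N : Finset (Fin ℓ) × Finset (Fin ℓ)}
    (hN : N ∈ ((Finset.Iio j).powerset ×ˢ (Finset.Iio j).powerset).filter
      (fun N : Finset (Fin ℓ) × Finset (Fin ℓ) => Disjoint N.1 N.2))
    {k₂ k₃ : ℕ} (h₂ : k₂ ∈ Finset.range 2) (h₃ : k₃ ∈ Finset.range (ℓ - (j.val + 1) + 1)) :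
    2 * N.1.card + 2 * N.2.card + (k₂ + 2 * k₃ +
      (2 * ℓ + 2 - 2 * (j.val + 1) - k₂ - 2 * k₃ +
        2 * (Finset.Iio j \ (N.1 ∪ N.2)).card)) = 2 * ℓ := by
  simp only [Finset.mem_filter, Finset.mem_product, Finset.mem_powerset] at hN
  have hs : N.1 ∪ N.2 ⊆ Finset.Iio j := Finset.union_subset hN.1.1 hN.1.2
  have h1 := Finset.card_sdiff_add_card_eq_card hs
  rw [Finset.card_union_of_disjoint hN.2, Fin.card_Iio] at h1
  have := Finset.mem_range.1 h₂
  have := Finset.mem_range.1 h₃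
  have := j.isLt
  omega

theorem isHomogeneous_homogBernoulliLike (r s : ℕ) (i : Fin ℓ) :
    (homogBernoulliLike r s i).IsHomogeneous (r + 2 * s) := by
  have h := (Polynomial.isHomogeneous_homogenize (n := r + 2 * s) (bernoulliLike r s)).aeval
    ![x i, z ℓ] (n := 1) fun k => by
      fin_cases k
      · exact isHomogeneous_X _ _
      · exact isHomogeneous_X _ _
  rwa [one_mul] at h

theorem isHomogeneous_phiCoeff (j i : Fin ℓ) : (phiCoeff j i).IsHomogeneous (2 * ℓ) := by
  refine IsHomogeneous.sum _ _ _ fun N hN => ?_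
  simp only [Finset.mul_sum]
  refine IsHomogeneous.sum _ _ _ fun k₂ h₂ => IsHomogeneous.sum _ _ _ fun k₃ h₃ => ?_
  refine Eq.subst (motive := fun n => IsHomogeneous _ n)
    (phiCoeff_degree_identity hN h₂ h₃) ?_
  have hx : ∀ t : Fin ℓ, (x t).IsHomogeneous 1 := fun t => isHomogeneous_X _ _
  have hz : (z ℓ).IsHomogeneous 1 := isHomogeneous_X _ _
  refine IsHomogeneous.mul (IsHomogeneous.mul ?_ ?_) (IsHomogeneous.mul ?_
    (isHomogeneous_homogBernoulliLike _ _ _))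
  · have h := IsHomogeneous.prod N.1 (fun t => x t ^ 2) (fun _ => 2) fun t _ => (hx t).pow 2
    rwa [Finset.sum_const, smul_eq_mul, mul_comm] at h
  · have h := IsHomogeneous.prod N.2 (fun t => -(x t * z ℓ)) (fun _ => 2)
      fun t _ => ((hx t).mul hz).neg
    rwa [Finset.sum_const, smul_eq_mul, mul_comm] at h
  · have h1 := isHomogeneous_esymm_map {j} hx k₂
    have h2 := isHomogeneous_esymm_map (Finset.Ioi j) (fun t => (hx t).pow 2) k₃
    have h3 : ((-1 : S ℓ) ^ (k₂ + k₃)).IsHomogeneous 0 := by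
      simpa using (isHomogeneous_one (Option (Fin ℓ)) ℝ).neg.pow (k₂ + k₃)
    simpa using h3.mul (h1.mul h2)

theorem isHomogeneous_phi (j : Fin ℓ) : IsHomogeneousDerivation (phi j) (2 * ℓ) := by
  rintro (_ | i)
  · rw [show phi j (X none) = 0 from phi_z j]
    exact isHomogeneous_zero _ _ _
  · rw [show phi j (X (some i)) = (-1) ^ (j.val + 1) * phiCoeff j i from phi_x j i]
    have h : ((-1 : S ℓ) ^ (j.val + 1)).IsHomogeneous 0 := by
      simpa using (isHomogeneous_one (Option (Fin ℓ)) ℝ).neg.pow (j.val + 1)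
    simpa using h.mul (isHomogeneous_phiCoeff j i)

theorem natDegree_phiValue_le (j : Fin ℓ) (y : Fin ℓ → ℝ) :
    (phiValue j (fun t => Polynomial.C (y t)) 1 Polynomial.X).natDegree ≤ 2 * ℓ := by
  refine Polynomial.natDegree_sum_le_of_forall_le _ _ fun N hN => ?_
  have hA : (∏ t ∈ N.1, Polynomial.C (y t) ^ 2) * (∏ t ∈ N.2, (-(Polynomial.C (y t) * 1))) =
      Polynomial.C ((∏ t ∈ N.1, y t ^ 2) * (∏ t ∈ N.2, -y t)) := by
    simp
  rw [hA]
  refine (Polynomial.natDegree_C_mul_le _ _).trans ?_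
  refine Polynomial.natDegree_sum_le_of_forall_le _ _ fun k₂ h₂ =>
    Polynomial.natDegree_sum_le_of_forall_le _ _ fun k₃ h₃ => ?_
  have hB : (-1) ^ (k₂ + k₃) * (({Polynomial.C (y j)} : Multiset (Polynomial ℝ)).esymm k₂ *
        ((Finset.Ioi j).val.map (fun t => Polynomial.C (y t) ^ 2)).esymm k₃) =
      Polynomial.C ((-1) ^ (k₂ + k₃) * (({y j} : Multiset ℝ).esymm k₂ *
        ((Finset.Ioi j).val.map (fun t => y t ^ 2)).esymm k₃)) := by
    simp [map_multiset_esymm, Multiset.map_map]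
  rw [hB]
  refine (Polynomial.natDegree_C_mul_le _ _).trans ?_
  have h : ∀ r s, homogValue r s Polynomial.X 1 = bernoulliLike r s := fun r s =>
    Polynomial.aeval_homogenize_X_one _ (natDegree_bernoulliLike_le r s)
  simp only [h]
  refine (natDegree_bernoulliLike_le _ _).trans ?_
  have := phiCoeff_degree_identity hN h₂ h₃
  omega

end Degree

/-! ### Nonvanishing of the determinant -/

section Nonvanishing

/-- At the point `x_t = 2t`, `z = 1` the coefficient vectors of the `φ_j` are independent. -/
theorem eq_zero_of_sum_phiValue_eq_zero {y : Fin ℓ → ℝ} (hy : ∀ t, y t = 2 * (t.val + 1))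
    {c : Fin ℓ → ℝ} (hc : ∀ i, ∑ j, phiValue j y 1 (y i) * c j = 0) : c = 0 := by
  let P : Fin ℓ → Polynomial ℝ := fun j =>
    phiValue j (fun t => Polynomial.C (y t)) 1 Polynomial.X
  have hP : ∀ j u, (P j).eval u = phiValue j y 1 u := fun j u => by
    have h := map_phiValue (Polynomial.aeval u) j (fun t => Polynomial.C (y t)) 1 Polynomial.X
    simpa [← Polynomial.coe_aeval_eq_eval] using h
  let p : Polynomial ℝ := ∑ j, Polynomial.C (c j) * P j
  have hp : ∀ u, p.eval u = ∑ j, phiValue j y 1 u * c j := fun u => by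
    simp [p, Polynomial.eval_finsetSum, hP, mul_comm]
  have hpos : ∀ t, 0 < y t := fun t => by rw [hy]; positivity
  have hmono : ∀ {s t : Fin ℓ}, s < t → y s + 2 ≤ y t := fun {s t} hst => by
    have : ((s.val + 1 : ℕ) : ℝ) ≤ (t.val : ℝ) := Nat.cast_le.2 hst
    rw [hy, hy]
    push_cast at this
    linarith
  have hinj : Function.Injective y := fun s t hst => by
    rcases lt_trichotomy s t with h | h | h
    · linarith [hmono h]
    · exact h
    · linarith [hmono h]
  -- By oddness `p` vanishes at `0` and at all `±y i`: these are `2ℓ + 1` distinct points, while its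
  -- degree is at most `2ℓ`.
  have hp0 : p = 0 := by
    refine Polynomial.eq_zero_of_natDegree_lt_card_of_eval_eq_zero p
      (f := fun o : Option (Fin ℓ ⊕ Fin ℓ) => o.elim 0 (Sum.elim y fun i => -y i)) ?_ ?_ ?_
    · rintro (_ | s | s) (_ | t | t) h <;> simp only [Option.elim, Sum.elim_inl, Sum.elim_inr] at h
      · rfl
      · linarith [hpos t]
      · linarith [hpos t]
      · linarith [hpos s]
      · rw [hinj h]
      · linarith [hpos s, hpos t]
      · linarith [hpos s]
      · linarith [hpos s, hpos t]
      · rw [hinj (neg_injective h)]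
    · rintro (_ | s | s)
      · simp [hp, phiValue_zero]
      · simp [hp, hc]
      · simp [hp, hc, phiValue_neg]
    · refine Nat.lt_of_le_of_lt (Polynomial.natDegree_sum_le_of_forall_le _ _ fun j _ =>
        (Polynomial.natDegree_C_mul_le _ _).trans (natDegree_phiValue_le j y)) ?_
      simp
      omega
  have hsum : ∀ u, ∑ j, phiValue j y 1 u * c j = 0 := fun u => by rw [← hp, hp0]; simp
  have hdiff : ∀ u, ∑ j, ((∏ t ∈ Finset.Iio j, ((y t + u) * (y t - u - 1))) *
      (tailFactor j y (u + 1) - tailFactor j y (-u))) * c j = 0 := fun u => by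
    have h : (2 * u + 1) * (∑ j, phiValue j y 1 (u + 1) * c j - ∑ j, phiValue j y 1 u * c j) = 0 := by
      rw [hsum, hsum, sub_zero, mul_zero]
    rw [← h, ← Finset.sum_sub_distrib, Finset.mul_sum]
    refine Finset.sum_congr rfl fun j _ => ?_
    rw [← sub_mul, ← mul_assoc, phiValue_difference, one_mul]
  funext i
  induction i using WellFoundedLT.induction with
  | ind i ih =>
    -- At `u = y i - 1` the factor `y i - u - 1` kills every term with `j > i`, and the induction
    -- hypothesis kills those with `j < i`. In the term `j = i` only `-T_i(1 - y i)` remains of the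
    -- difference of tail factors, and it is nonzero.
    have h := hdiff (y i - 1)
    rw [Finset.sum_eq_single i (fun j _ hj => ?_) (by simp)] at h
    · refine (mul_eq_zero.1 h).resolve_left (mul_ne_zero ?_ ?_)
      · refine Finset.prod_ne_zero_iff.2 fun t ht => mul_ne_zero ?_ ?_
        · have := hpos t
          have := hmono (Finset.mem_Iio.1 ht)
          exact ne_of_gt (by linarith)
        · have := hmono (Finset.mem_Iio.1 ht)
          exact ne_of_lt (by linarith)
      · have hi : 2 ≤ y i := by
          rw [hy]
          have : (0 : ℝ) ≤ i.val := Nat.cast_nonneg _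
          linarith
        rw [sub_add_cancel, tailFactor_eq_zero le_rfl, zero_sub, neg_ne_zero, tailFactor]
        refine mul_ne_zero (mul_ne_zero ?_ ?_) (Finset.prod_ne_zero_iff.2 fun t ht => ?_)
        · exact ne_of_lt (by linarith)
        · exact ne_of_lt (by linarith)
        · have := hmono (Finset.mem_Ioi.1 ht)
          rw [sq_sub_sq]
          exact mul_ne_zero (ne_of_gt (by linarith)) (ne_of_lt (by linarith))
    · rcases lt_or_gt_of_ne hj with hlt | hlt
      · rw [ih j hlt, Pi.zero_apply, mul_zero]
      · rw [Finset.prod_eq_zero (Finset.mem_Iio.2 hlt) (by ring), zero_mul, zero_mul]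

end Nonvanishing

/-! ### Saito's criterion and the basis -/

/-- The matrix of coefficients of `φ_1, …, φ_ℓ` at `∂_1, …, ∂_ℓ`. -/
noncomputable def phiMatrix (ℓ : ℕ) : Matrix (Fin ℓ) (Fin ℓ) (S ℓ) :=
  Matrix.of fun i j => phi j (x i)

theorem det_phiMatrix_ne_zero : (phiMatrix ℓ).det ≠ 0 := by
  intro h0
  let y : Fin ℓ → ℝ := fun t => 2 * (t.val + 1)
  let e : S ℓ →ₐ[ℝ] ℝ := aeval fun o => o.elim 1 y
  have hex : ∀ t, e (x t) = y t := fun t => by simp [e, x]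
  have hez : e (z ℓ) = 1 := by simp [e, z]
  have hdet : (e.mapMatrix (phiMatrix ℓ)).det = 0 := by rw [← AlgHom.map_det, h0, map_zero]
  obtain ⟨c, hc, hcz⟩ := Matrix.exists_mulVec_eq_zero_iff.2 hdet
  -- The signs `(-1)^j` of the `φ_j` are absorbed into the kernel vector.
  have h := eq_zero_of_sum_phiValue_eq_zero (y := y) (fun _ => rfl)
    (c := fun j => (-1) ^ (j.val + 1) * c j) fun i => by
      refine Eq.trans ?_ (congrFun hcz i)
      rw [Matrix.mulVec, dotProduct]
      refine Finset.sum_congr rfl fun j _ => ?_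
      simp only [AlgHom.mapMatrix_apply, Matrix.map_apply, phiMatrix, Matrix.of_apply, phi_x,
        map_mul, map_pow, map_neg, map_one, map_phiValue, hex, hez]
      ring
  refine hc (funext fun j => ?_)
  simpa using congrFun h j

theorem isHomogeneous_det_phiMatrix : (phiMatrix ℓ).det.IsHomogeneous (2 * ℓ * ℓ) := by
  rw [Matrix.det_apply]
  refine IsHomogeneous.sum _ _ _ fun σ _ => ?_
  have h := IsHomogeneous.prod Finset.univ (fun i => phiMatrix ℓ (σ i) i) (fun _ => 2 * ℓ)
    fun i _ => isHomogeneous_phi i (some (σ i))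
  rw [Finset.sum_const, Finset.card_univ, Fintype.card_fin, smul_eq_mul, mul_comm] at h
  rcases Int.units_eq_one_or (Equiv.Perm.sign σ) with hσ | hσ
  · rwa [hσ, one_smul]
  · rw [hσ, Units.neg_smul, one_smul]
    exact h.neg

/-- The product of the forms divides the determinant, and both are nonzero of degree `2ℓ²`, so the
quotient is constant. -/
theorem exists_det_phiMatrix_eq :
    ∃ c : ℝ, c ≠ 0 ∧ (phiMatrix ℓ).det = affineProduct ℓ * C c := by
  obtain ⟨f, hf⟩ := affineProduct_dvd_det (N := phiMatrix ℓ)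
    fun j => ⟨phi j, phi_mem j, phi_z j, fun _ => rfl⟩
  have hne := det_phiMatrix_ne_zero (ℓ := ℓ)
  have hd := isHomogeneous_det_phiMatrix.totalDegree hne
  have hf0 : f ≠ 0 := by
    rintro rfl
    simp [hf] at hne
  rw [hf, totalDegree_mul_of_isDomain affineProduct_ne_zero hf0,
    isHomogeneous_affineProduct.totalDegree affineProduct_ne_zero] at hd
  have hC := totalDegree_eq_zero_iff_eq_C.1 (show f.totalDegree = 0 by omega)
  refine ⟨coeff 0 f, fun h => hf0 ?_, by rw [hf, ← hC]⟩
  rw [hC, h, C_0]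

theorem eulerDerivation_x (i : Fin ℓ) : eulerDerivation ℓ (x i) = x i := by
  simp only [eulerDerivation, Derivation.add_apply, Derivation.smul_apply, derivation_sum_apply,
    partialX, partialZ, x, z, smul_eq_mul]
  rw [pderiv_X_of_ne (by simp), mul_zero, zero_add,
    Finset.sum_eq_single i (fun k _ hk => ?_) (by simp)]
  · simp
  · rw [pderiv_X_of_ne (by simpa using hk.symm), mul_zero]

theorem eulerDerivation_z : eulerDerivation ℓ (z ℓ) = z ℓ := by
  simp only [eulerDerivation, Derivation.add_apply, Derivation.smul_apply, derivation_sum_apply,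
    partialX, partialZ, z, smul_eq_mul]
  rw [Finset.sum_eq_zero fun k _ => by rw [pderiv_X_of_ne (by simp), mul_zero]]
  simp

theorem eulerDerivation_mem : eulerDerivation ℓ ∈ derivationModule ℓ := by
  refine ⟨by rw [eulerDerivation_z], fun α hα => ?_⟩
  have h : eulerDerivation ℓ α = α := by
    rcases hα with ⟨i, rfl⟩ | ⟨p, q, -, rfl | rfl⟩
    · exact eulerDerivation_x i
    · rw [map_add, eulerDerivation_x, eulerDerivation_x]
    · rw [map_sub, eulerDerivation_x, eulerDerivation_x]
  rw [map_sub, h, eulerDerivation_z]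
  exact ⟨dvd_rfl, dvd_rfl⟩

theorem derivation_eq_of_forall {θ η : Derivation ℝ (S ℓ) (S ℓ)} (hz : θ (z ℓ) = η (z ℓ))
    (hx : ∀ i, θ (x i) = η (x i)) : θ = η :=
  derivation_ext fun o => by
    rcases o with _ | i
    · exact hz
    · exact hx i

/-- The numerators in Cramer's rule are determinants with one column replaced by the coefficients of
`θ`. All columns still come from the derivation module, so `affineProduct` divides the numerators
and the solution is polynomial. -/
theorem exists_eq_sum_phi {θ : Derivation ℝ (S ℓ) (S ℓ)} (hθ : θ ∈ derivationModule ℓ)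
    (hz : θ (z ℓ) = 0) : ∃ g : Fin ℓ → S ℓ, θ = ∑ j, g j • phi j := by
  obtain ⟨c, hc, hdet⟩ := exists_det_phiMatrix_eq (ℓ := ℓ)
  have hdvd : ∀ j, affineProduct ℓ ∣ (phiMatrix ℓ).cramer (fun i => θ (x i)) j := fun j => by
    rw [Matrix.cramer_apply]
    refine affineProduct_dvd_det fun k => ?_
    by_cases hk : k = j
    · exact ⟨θ, hθ, hz, fun i => by rw [hk, Matrix.updateCol_self]⟩
    · exact ⟨phi k, phi_mem k, phi_z k, fun i => by rw [Matrix.updateCol_ne hk]; rfl⟩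
  choose h hh using hdvd
  refine ⟨fun j => C c⁻¹ * h j, derivation_eq_of_forall ?_ fun i => ?_⟩
  · simp [hz, derivation_sum_apply, phi_z]
  · have h1 := congrFun (Matrix.mulVec_cramer (phiMatrix ℓ) fun i => θ (x i)) i
    rw [Matrix.mulVec, dotProduct, Pi.smul_apply, smul_eq_mul, hdet] at h1
    have h2 : affineProduct ℓ * ∑ j, phi j (x i) * h j = affineProduct ℓ * (C c * θ (x i)) := by
      rw [← mul_assoc, ← h1, Finset.mul_sum]
      refine Finset.sum_congr rfl fun j _ => ?_
      rw [hh, phiMatrix, Matrix.of_apply]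
      ring
    have h3 := mul_left_cancel₀ affineProduct_ne_zero h2
    have hcc : (C c⁻¹ * C c : S ℓ) = 1 := by rw [← C_mul, inv_mul_cancel₀ hc, C_1]
    rw [derivation_sum_apply, ← one_mul (θ (x i)), ← hcc, mul_assoc, ← h3, Finset.mul_sum]
    refine Finset.sum_congr rfl fun j _ => ?_
    rw [Derivation.smul_apply, smul_eq_mul]
    ring

/-- The derivations `θ_E, φ_1, …, φ_ℓ` as elements of the derivation module. -/
noncomputable def basisFun (ℓ : ℕ) (o : Option (Fin ℓ)) : derivationModule ℓ :=
  o.elim ⟨eulerDerivation ℓ, eulerDerivation_mem⟩ fun j => ⟨phi j, phi_mem j⟩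

theorem eq_zero_of_sum_basisFun (g : Option (Fin ℓ) → S ℓ)
    (hg : ∑ o, g o • basisFun ℓ o = 0) : ∀ o, g o = 0 := by
  have h : g none • eulerDerivation ℓ + ∑ j, g (some j) • phi j = 0 := by
    simpa [Fintype.sum_option, basisFun] using congrArg Subtype.val hg
  have h0 : g none = 0 := by
    have h1 := congrArg (fun θ : Derivation ℝ (S ℓ) (S ℓ) => θ (z ℓ)) h
    simp only [Derivation.add_apply, Derivation.smul_apply, derivation_sum_apply, phi_z,
      eulerDerivation_z, smul_eq_mul, mul_zero, Finset.sum_const_zero, add_zero,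
      Derivation.zero_apply] at h1
    exact (mul_eq_zero.1 h1).resolve_right (X_ne_zero _)
  have h2 : (phiMatrix ℓ).mulVec (fun j => g (some j)) = 0 := by
    funext i
    have h1 := congrArg (fun θ : Derivation ℝ (S ℓ) (S ℓ) => θ (x i)) h
    simp only [h0, zero_smul, zero_add, derivation_sum_apply, Derivation.smul_apply, smul_eq_mul,
      Derivation.zero_apply] at h1
    rw [Matrix.mulVec, dotProduct, Pi.zero_apply, ← h1]
    exact Finset.sum_congr rfl fun j _ => mul_comm _ _
  rintro (_ | j)
  · exact h0
  · exact congrFun (Matrix.eq_zero_of_mulVec_eq_zero det_phiMatrix_ne_zero h2) j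

theorem linearIndependent_basisFun : LinearIndependent (S ℓ) (basisFun ℓ) :=
  (Fintype.linearIndependent_iff (R := S ℓ) (M := derivationModule ℓ) (v := basisFun ℓ)).2
    eq_zero_of_sum_basisFun

theorem span_basisFun : ⊤ ≤ Submodule.span (S ℓ) (Set.range (basisFun ℓ)) := by
  rintro ⟨θ, hθ⟩ -
  obtain ⟨f, hf⟩ := hθ.1
  -- Since `θ(z) = z f` and `θ_E(z) = z`, subtracting `f θ_E` leaves a derivation that kills `z`.
  have hE : θ - f • eulerDerivation ℓ ∈ derivationModule ℓ :=
    Submodule.sub_mem _ hθ (Submodule.smul_mem _ _ eulerDerivation_mem)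
  obtain ⟨g, hg⟩ := exists_eq_sum_phi hE (by
    rw [Derivation.sub_apply, Derivation.smul_apply, eulerDerivation_z, hf, smul_eq_mul]
    ring)
  have h : (⟨θ, hθ⟩ : derivationModule ℓ) =
      f • basisFun ℓ none + ∑ j, g j • basisFun ℓ (some j) := by
    refine Subtype.ext ?_
    simpa [basisFun] using (sub_eq_iff_eq_add'.1 hg)
  rw [h]
  exact Submodule.add_mem _ (Submodule.smul_mem _ _ (Submodule.subset_span ⟨none, rfl⟩))
    (Submodule.sum_mem _ fun j _ =>
      Submodule.smul_mem _ _ (Submodule.subset_span ⟨some j, rfl⟩))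

end ShiB

theorem theorem3p3 (ℓ : ℕ) (hℓ : 1 ≤ ℓ) :
    (∀ j : Fin ℓ, ShiB.IsHomogeneousDerivation (ShiB.phi j) (2 * ℓ)) ∧
    ∃ b : Module.Basis (Option (Fin ℓ)) (ShiB.S ℓ) (ShiB.derivationModule ℓ),
      (b none : Derivation ℝ (ShiB.S ℓ) (ShiB.S ℓ)) = ShiB.eulerDerivation ℓ ∧
      ∀ j : Fin ℓ, (b (some j) : Derivation ℝ (ShiB.S ℓ) (ShiB.S ℓ)) = ShiB.phi j := by
  refine ⟨ShiB.isHomogeneous_phi,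
    Module.Basis.mk ShiB.linearIndependent_basisFun ShiB.span_basisFun, ?_, fun j => ?_⟩
  · rw [Module.Basis.mk_apply]
    rfl
  · rw [Module.Basis.mk_apply]
    rfl
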